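/- Let $p\in(1,2]$, let $q\in[2,\infty)$ be its conjugate exponent, $\frac1p+\frac1q=1$, and let $T>0$. Let $k:(0,T]\to\mathbb{R}$ be strictly convex and decreasing on $(0,T]$, with $k\in L^{q/2}(0,T)$ and $\int_0^T k(t)\,dt>0$. Then, for every real-valued $u\in L^p(0,T)$, the integral $$\mathcal{A}u(t)=\int_0^t k(t-\tau)\,u(\tau)\,d\tau$$ converges absolutely for almost every $t\in(0,T)$, and $\mathcal{A}$ defines a bounded linear map $\mathcal{A}:L^p(0,T)\to L^q(0,T)$ which is strictly monotone, that is, $$\int_0^T\bigl(\mathcal{A}u(t)-\mathcal{A}v(t)\bigr)\bigl(u(t)-v(t)\bigr)\,dt\ \ge\ 0\qquad\text{for all }u,v\in L^p(0,T),$$ with equality only if $u=v$ (as elements of $L^p(0,T)$). -/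

import Mathlib

open MeasureTheory Set
open scoped ENNReal

noncomputable section

/-- Lebesgue measure on the open interval `(0, T)`, so that `Lp ℝ p (intervalMeasure T)` is the
real space `L^p(0, T)`. -/
abbrev intervalMeasure (T : ℝ) : Measure ℝ := volume.restrict (Ioo 0 T)

/-- The convolutional Volterra integral `t ↦ ∫_0^t k(t - τ) u(τ) dτ`. -/
def volterraIntegral (k u : ℝ → ℝ) (t : ℝ) : ℝ := ∫ τ in (0 : ℝ)..t, k (t - τ) * u τ

/-- The duality pairing `⟨f, u⟩ = ∫ f u` between `L^q` and `L^p`, where `q` is the exponent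
conjugate to `p` (so that the product is integrable). -/
def dualityPairing {α : Type*} [MeasurableSpace α] {μ : Measure α} {p q : ℝ≥0∞}
    [p.HolderConjugate q] (f : Lp ℝ q μ) (u : Lp ℝ p μ) : ℝ := ∫ x, f x * u x ∂μ

/-- A map `A : L^p → L^q = (L^p)*` is monotone if `⟨A u - A v, u - v⟩ ≥ 0` for all `u, v`. -/
def IsMonotoneMap {α : Type*} [MeasurableSpace α] {μ : Measure α} {p q : ℝ≥0∞}
    [p.HolderConjugate q] (A : Lp ℝ p μ → Lp ℝ q μ) : Prop :=
  ∀ u v : Lp ℝ p μ, 0 ≤ dualityPairing (A u - A v) (u - v)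

/-- A monotone map is strictly monotone if `⟨A u - A v, u - v⟩ = 0` only when `u = v`. -/
def IsStrictlyMonotoneMap {α : Type*} [MeasurableSpace α] {μ : Measure α} {p q : ℝ≥0∞}
    [p.HolderConjugate q] (A : Lp ℝ p μ → Lp ℝ q μ) : Prop :=
  IsMonotoneMap A ∧ ∀ u v : Lp ℝ p μ, dualityPairing (A u - A v) (u - v) = 0 → u = v

end

/-! Positivity comes from an even, `2T`-periodic extension of the kernel. Put `K(x) = k(min(x, 2T -
x))` on `(0, 2T)`. For `t ≠ s` in `(0, T)` the value of `K` at `t - s` modulo `2T` is `k(|t - s|)`,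
so symmetrizing the Volterra form gives `2⟨Au, u⟩ = ∫∫ K(t - s) u(s) u(t)`, which the Fourier series
on the circle diagonalizes with the coefficients of `K` as weights.

These weights have positive real part: at frequency zero this is the mean of `k`; at the others it
holds because `K` is strictly convex on a whole period (`StrictConvexOn.comp_min_reflect`) and a
strictly convex function has positive cosine coefficients (`StrictConvexOn.integral_mul_cos_pos`).

Parseval needs `L^2`, while `u` is only in `L^p` with `p ≤ 2`. So for bounded `u` a single term of
the series is kept as a lower bound, and that inequality passes to `L^p` by density
(`dualityPairing_volterra_ge`). If the form vanishes, every Fourier coefficient of `u` does, hence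
`u = 0`. Boundedness of `A` is Young's inequality, as `1/p + 2/q = 1 + 1/q`. -/

/-! ### Cosine coefficients of strictly convex functions -/

/-- The affine function is the chord of `f` through the two zeros of the cosine. Strict convexity
puts `f` below the chord between them and above it outside, which is exactly the sign pattern of the
cosine. -/
theorem StrictConvexOn.sub_chord_mul_pos {f : ℝ → ℝ} {a P : ℝ} (hP : 0 < P)
    (hf : StrictConvexOn ℝ (Ioo a (a + P)) f) :
    ∃ c d : ℝ, ∀ x ∈ Ioo a (a + P), x ≠ a + P / 4 → x ≠ a + 3 * P / 4 →
      0 < (f x - (c + d * (x - a))) * Real.cos (2 * Real.pi / P * (x - a)) := by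
  set y := a + P / 4 with hy
  set z := a + 3 * P / 4 with hz
  have hyz : 0 < z - y := by rw [hy, hz]; linarith
  have hym : y ∈ Ioo a (a + P) := by constructor <;> linarith
  have hzm : z ∈ Ioo a (a + P) := by constructor <;> linarith
  set d := (f z - f y) / (z - y) with hd
  have hdz : d * (z - y) = f z - f y := by rw [hd]; field_simp
  refine ⟨f y - d * (P / 4), d, fun x hx hxy hxz => ?_⟩
  have hl : f y - d * (P / 4) + d * (x - a) = f y + d * (x - y) := by rw [hy]; ring
  rw [hl]
  have hpi := Real.pi_pos
  have e1 : 2 * Real.pi / P * (x - a) = Real.pi / 2 + 2 * Real.pi / P * (x - y) := by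
    rw [hy]; field_simp; ring
  have e2 : 2 * Real.pi / P * (x - a) = 3 * Real.pi / 2 + 2 * Real.pi / P * (x - z) := by
    rw [hz]; field_simp; ring
  have e3 : 2 * Real.pi / P * (x - a) = 2 * Real.pi + 2 * Real.pi / P * (x - (a + P)) := by
    field_simp; ring
  have hω : 0 < 2 * Real.pi / P := by positivity
  rcases lt_or_gt_of_ne hxy with h | h
  · have hs := hf.slope_strict_mono_adjacent hx hzm h (by linarith)
    rw [← hd, div_lt_iff₀ (by linarith)] at hs
    refine mul_pos (by nlinarith) (Real.cos_pos_of_mem_Ioo ⟨?_, ?_⟩)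
    · have : 0 < 2 * Real.pi / P * (x - a) := mul_pos hω (by linarith [hx.1])
      linarith
    · have : 2 * Real.pi / P * (x - y) < 0 := mul_neg_of_pos_of_neg hω (by linarith)
      linarith
  rcases lt_or_gt_of_ne hxz with h' | h'
  · have hs := hf.slope_strict_mono_adjacent hym hzm h h'
    rw [div_lt_div_iff₀ (by linarith) (by linarith)] at hs
    have : f x < f y + d * (x - y) := by
      have h1 : (f x - f y) * (z - y) < (d * (z - y)) * (x - y) := by rw [hdz]; linarith
      have h2 : f x - f y < d * (x - y) := by
        by_contra hcon
        push Not at hcon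
        nlinarith
      linarith
    refine mul_pos_of_neg_of_neg (by linarith) (Real.cos_neg_of_pi_div_two_lt_of_lt ?_ ?_)
    · have : 0 < 2 * Real.pi / P * (x - y) := mul_pos hω (by linarith)
      linarith
    · have : 2 * Real.pi / P * (x - z) < 0 := mul_neg_of_pos_of_neg hω (by linarith)
      linarith
  · have hs := hf.slope_strict_mono_adjacent hym hx (by linarith) h'
    rw [← hd, lt_div_iff₀ (by linarith)] at hs
    have hcos : Real.cos (2 * Real.pi / P * (x - a))
        = Real.cos (2 * Real.pi / P * (x - (a + P))) := by
      rw [e3, add_comm, Real.cos_add_two_pi]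
    rw [hcos]
    refine mul_pos (by nlinarith) (Real.cos_pos_of_mem_Ioo ⟨?_, ?_⟩)
    · have : 0 < 2 * Real.pi / P * (x - z) := mul_pos hω (by linarith)
      linarith
    · have : 2 * Real.pi / P * (x - (a + P)) < 0 := mul_neg_of_pos_of_neg hω (by linarith [hx.2])
      linarith

theorem integral_affine_mul_cos_period {a P : ℝ} (hP : 0 < P) (c d : ℝ) :
    ∫ x in a..(a + P), (c + d * (x - a)) * Real.cos (2 * Real.pi / P * (x - a)) = 0 := by
  set ω := 2 * Real.pi / P with hω
  have hω0 : ω ≠ 0 := by positivity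
  have hωP : ω * P = 2 * Real.pi := by rw [hω]; field_simp
  have hder : ∀ x ∈ uIcc a (a + P), HasDerivAt
      (fun x => (c + d * (x - a)) * (Real.sin (ω * (x - a)) / ω)
        + d * (Real.cos (ω * (x - a)) / ω ^ 2))
      ((c + d * (x - a)) * Real.cos (ω * (x - a))) x := by
    intro x _
    have h1 : HasDerivAt (fun x => x - a) 1 x := (hasDerivAt_id x).sub_const a
    have h2 : HasDerivAt (fun x => ω * (x - a)) (ω * 1) x := h1.const_mul ω
    have h3 := ((h1.const_mul d).const_add c).mul (h2.sin.div_const ω)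
    have h4 := (h2.cos.div_const (ω ^ 2)).const_mul d
    convert! h3.add h4 using 1
    field_simp
    ring
  rw [intervalIntegral.integral_eq_sub_of_hasDerivAt hder
    (Continuous.intervalIntegrable (by fun_prop) _ _)]
  simp [hωP]

/-- Affine functions are orthogonal to this cosine over a full period, so subtracting the chord does
not change the integral and makes the integrand nonnegative. -/
theorem StrictConvexOn.integral_mul_cos_period_pos {f : ℝ → ℝ} {a P : ℝ} (hP : 0 < P)
    (hf : StrictConvexOn ℝ (Ioo a (a + P)) f) (hi : IntervalIntegrable f volume a (a + P)) :
    0 < ∫ x in a..(a + P), f x * Real.cos (2 * Real.pi / P * (x - a)) := by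
  obtain ⟨c, d, h⟩ := hf.sub_chord_mul_pos hP
  have hcos : Continuous fun x : ℝ => Real.cos (2 * Real.pi / P * (x - a)) := by fun_prop
  have hi1 : IntervalIntegrable (fun x => f x * Real.cos (2 * Real.pi / P * (x - a))) volume
      a (a + P) := hi.mul_continuousOn hcos.continuousOn
  have hi2 : IntervalIntegrable
      (fun x => (c + d * (x - a)) * Real.cos (2 * Real.pi / P * (x - a))) volume a (a + P) :=
    Continuous.intervalIntegrable (by fun_prop) _ _
  have heq : ∫ x in a..(a + P), f x * Real.cos (2 * Real.pi / P * (x - a))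
      = ∫ x in a..(a + P),
        (f x - (c + d * (x - a))) * Real.cos (2 * Real.pi / P * (x - a)) := by
    simp_rw [sub_mul (f _)]
    rw [intervalIntegral.integral_sub hi1 hi2, integral_affine_mul_cos_period hP, sub_zero]
  rw [heq]
  have hi3 : IntervalIntegrable
      (fun x => (f x - (c + d * (x - a))) * Real.cos (2 * Real.pi / P * (x - a))) volume
        a (a + P) := by
    simpa only [sub_mul (f _)] using! hi1.sub hi2
  rw [intervalIntegral.integral_pos_iff_support_of_nonneg_ae' _ hi3]
  -- The first quarter period already lies in the support of the integrand.
  · refine ⟨by linarith, lt_of_lt_of_le (b := volume (Ioo a (a + P / 4))) (by simp; linarith)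
      (measure_mono fun x hx => ⟨?_, ?_⟩)⟩
    · exact (h x ⟨hx.1, by linarith [hx.2]⟩ hx.2.ne (by linarith [hx.2])).ne'
    · exact ⟨hx.1, by linarith [hx.2]⟩
  · rw [uIoc_of_le (by linarith)]
    have hne : ∀ b : ℝ, ∀ᵐ x : ℝ ∂(volume.restrict (Ioc a (a + P))), x ≠ b := fun b =>
      ae_restrict_of_ae (Measure.ae_ne volume b)
    filter_upwards [ae_restrict_mem measurableSet_Ioc, hne (a + P / 4), hne (a + 3 * P / 4),
      hne (a + P)] with x hx h1 h2 h3
    exact (h x ⟨hx.1, lt_of_le_of_ne hx.2 h3⟩ h1 h2).le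

/-- The interval splits into `n` periods of the cosine, each contributing a positive amount. -/
theorem StrictConvexOn.integral_mul_cos_pos {f : ℝ → ℝ} {L : ℝ} (hL : 0 < L)
    (hf : StrictConvexOn ℝ (Ioo 0 L) f) (hi : IntervalIntegrable f volume 0 L)
    {n : ℕ} (hn : 0 < n) :
    0 < ∫ x in (0 : ℝ)..L, f x * Real.cos (2 * Real.pi * n / L * x) := by
  have hn' : (0 : ℝ) < n := by exact_mod_cast hn
  set P := L / n with hPdef
  have hP : 0 < P := by positivity
  have hnP : n * P = L := by rw [hPdef]; field_simp
  have hstep : ∀ j : ℕ, ((j + 1 : ℕ) : ℝ) * P = j * P + P := fun j => by push_cast; ring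
  have hle : ∀ j < n, (j : ℝ) * P + P ≤ L := fun j hj => by
    rw [← hstep, ← hnP]
    exact mul_le_mul_of_nonneg_right (by exact_mod_cast hj) hP.le
  have hi' : ∀ j < n, IntervalIntegrable f volume (j * P) (j * P + P) := fun j hj => by
    refine hi.mono_set ?_
    rw [uIcc_of_le (by linarith), uIcc_of_le hL.le]
    exact Icc_subset_Icc (by positivity) (hle j hj)
  have hcos : ContinuousOn (fun x : ℝ => Real.cos (2 * Real.pi * n / L * x)) univ := by fun_prop
  have hsum := intervalIntegral.sum_integral_adjacent_intervals (a := fun j : ℕ => (j : ℝ) * P)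
    (f := fun x => f x * Real.cos (2 * Real.pi * n / L * x)) (μ := volume) (n := n)
    (fun j hj => by
      rw [hstep]
      exact (hi' j hj).mul_continuousOn (hcos.mono (subset_univ _)))
  simp only [Nat.cast_zero, zero_mul, hnP] at hsum
  rw [← hsum]
  refine Finset.sum_pos (fun j hj => ?_) ⟨0, by simpa using hn⟩
  have hj' := Finset.mem_range.1 hj
  rw [hstep]
  have hpos := StrictConvexOn.integral_mul_cos_period_pos (f := f) (a := j * P) hP
    (hf.subset (Ioo_subset_Ioo (by positivity) (hle j hj')) (convex_Ioo _ _)) (hi' j hj')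
  convert! hpos using 4 with x
  have : 2 * Real.pi * n / L * x = 2 * Real.pi / P * (x - j * P) + j * (2 * Real.pi) := by
    rw [← hnP]; field_simp; ring
  rw [this, Real.cos_add_nat_mul_two_pi]

/-! ### The reflected kernel -/

theorem StrictConvexOn.strictAntiOn_of_antitoneOn {s : Set ℝ} {f : ℝ → ℝ}
    (hf : StrictConvexOn ℝ s f) (ha : AntitoneOn f s) : StrictAntiOn f s := by
  intro x hx y hy hxy
  refine lt_of_le_of_ne (ha hx hy hxy.le) fun heq => ?_
  have h := hf.2 hx hy hxy.ne (by norm_num : (0 : ℝ) < 1 / 2)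
    (by norm_num : (0 : ℝ) < 1 / 2) (by norm_num)
  have hm := hf.1 hx hy (by norm_num : (0 : ℝ) ≤ 1 / 2) (by norm_num : (0 : ℝ) ≤ 1 / 2)
    (by norm_num)
  simp only [smul_eq_mul] at h hm
  have := ha hm hy (by linarith)
  linarith

/-- A decreasing convex function of the concave `min x (2T - x)` is convex. Strictness has two
sources: if the two minima differ, strict convexity of `k`; if they agree, the points are mirror
images, the minimum is strictly larger in between, and `k` is strictly decreasing. -/
theorem StrictConvexOn.comp_min_reflect {k : ℝ → ℝ} {T : ℝ} (hk : StrictConvexOn ℝ (Ioc 0 T) k)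
    (ha : AntitoneOn k (Ioc 0 T)) :
    StrictConvexOn ℝ (Ioo 0 (2 * T)) fun x => k (min x (2 * T - x)) := by
  have hs := hk.strictAntiOn_of_antitoneOn ha
  have hmem : ∀ x ∈ Ioo 0 (2 * T), min x (2 * T - x) ∈ Ioc 0 T := fun x hx =>
    ⟨lt_min hx.1 (by linarith [hx.2]), by
      rcases le_total x T with h | h
      · exact (min_le_left _ _).trans h
      · exact (min_le_right _ _).trans (by linarith)⟩
  refine ⟨convex_Ioo _ _, fun x hx y hy hxy a b hap hbp hab => ?_⟩
  have hz := convex_Ioo _ _ hx hy hap.le hbp.le hab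
  simp only [smul_eq_mul] at hz ⊢
  have hb : b = 1 - a := by linarith
  by_cases hg : min x (2 * T - x) = min y (2 * T - y)
  · have hsum : x + y = 2 * T := by
      rcases min_choice x (2 * T - x) with h1 | h1 <;>
      rcases min_choice y (2 * T - y) with h2 | h2 <;> rw [h1, h2] at hg
      · exact absurd hg hxy
      · linarith
      · linarith
      · exact absurd (by linarith) hxy
    rw [← hg, ← add_mul, hab, one_mul]
    refine hs (hmem x hx) (hmem _ hz) ?_
    have hy' : y = 2 * T - x := by linarith
    subst hy' hb
    rcases lt_or_gt_of_ne hxy with h | h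
    · rw [min_eq_left (by linarith : x ≤ 2 * T - x)]
      refine lt_min ?_ ?_ <;> nlinarith
    · rw [min_eq_right (by linarith : 2 * T - x ≤ x)]
      refine lt_min ?_ ?_ <;> nlinarith
  · have h := hk.2 (hmem x hx) (hmem y hy) hg hap hbp hab
    have hm := hk.1 (hmem x hx) (hmem y hy) hap.le hbp.le hab
    simp only [smul_eq_mul] at h hm
    refine lt_of_le_of_lt (ha hm (hmem _ hz) (le_min ?_ ?_)) h
    · gcongr
      exacts [min_le_left _ _, min_le_left _ _]
    · have h1 := mul_le_mul_of_nonneg_left (min_le_right x (2 * T - x)) hap.le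
      have h2 := mul_le_mul_of_nonneg_left (min_le_right y (2 * T - y)) hbp.le
      have : 2 * T - (a * x + b * y) = a * (2 * T - x) + b * (2 * T - y) := by subst hb; ring
      linarith

theorem intervalIntegrable_comp_min_reflect {k : ℝ → ℝ} {T : ℝ} (hT : 0 < T)
    (hk : IntervalIntegrable k volume 0 T) :
    IntervalIntegrable (fun x => k (min x (2 * T - x))) volume 0 (2 * T) ∧
      ∫ x in (0 : ℝ)..(2 * T), k (min x (2 * T - x)) = 2 * ∫ x in (0 : ℝ)..T, k x := by
  have e1 : EqOn (fun x => k (min x (2 * T - x))) k (uIcc 0 T) := fun x hx => by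
    rw [uIcc_of_le hT.le] at hx
    simp only [min_eq_left (by linarith [hx.2] : x ≤ 2 * T - x)]
  have e2 : EqOn (fun x => k (min x (2 * T - x))) (fun x => k (2 * T - x))
      (uIcc T (2 * T)) := fun x hx => by
    rw [uIcc_of_le (by linarith)] at hx
    simp only [min_eq_right (by linarith [hx.1] : 2 * T - x ≤ x)]
  have hk2 : IntervalIntegrable (fun x => k (2 * T - x)) volume T (2 * T) := by
    have := (hk.comp_sub_left (2 * T)).symm
    simpa [two_mul] using this
  have i1 : IntervalIntegrable (fun x => k (min x (2 * T - x))) volume 0 T :=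
    hk.congr (fun x hx => (e1 (uIoc_subset_uIcc hx)).symm)
  have i2 : IntervalIntegrable (fun x => k (min x (2 * T - x))) volume T (2 * T) :=
    hk2.congr (fun x hx => (e2 (uIoc_subset_uIcc hx)).symm)
  refine ⟨i1.trans i2, ?_⟩
  rw [← intervalIntegral.integral_add_adjacent_intervals i1 i2,
    intervalIntegral.integral_congr e1, intervalIntegral.integral_congr e2,
    intervalIntegral.integral_comp_sub_left (fun x => k x)]
  simp only [sub_self, two_mul, add_sub_cancel_right]

/-! ### Young's inequality and the Volterra operator -/

theorem lintegral_convolution_rpow_le {p q : ℝ} (hpq : p.HolderConjugate q) (hp : p ≤ 2)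
    {κ U : ℝ → ℝ≥0∞} (hκ : Measurable κ) (hU : AEMeasurable U) :
    ∫⁻ t, (∫⁻ s, κ (t - s) * U s) ^ q ≤
      (∫⁻ t, κ t ^ (q / 2)) ^ (2 : ℝ) * (∫⁻ s, U s ^ p) ^ (q / p) := by
  have hp0 := hpq.pos
  have hq0 := hpq.symm.pos
  have hinv : 1 / p + 1 / q = 1 := by simpa [one_div] using hpq.inv_add_inv_eq_one
  have hq2 : 2 ≤ q := by
    have h1 : 1 / 2 ≤ 1 / p := one_div_le_one_div_of_le hp0 hp
    have h2 : 1 / q ≤ 1 / 2 := by linarith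
    rwa [one_div_le_one_div hq0 two_pos] at h2
  have hw : 0 ≤ 1 / p - 1 / q := by
    have h2 : 1 / q ≤ 1 / 2 := one_div_le_one_div_of_le two_pos hq2
    linarith
  have hκr : Measurable fun t => κ t ^ (q / 2) := hκ.pow_const _
  have hUp : AEMeasurable fun s => U s ^ p := hU.pow_const _
  set I := ∫⁻ t, κ t ^ (q / 2) with hI
  set J := ∫⁻ s, U s ^ p with hJ
  -- Hölder with three factors: `κU = (κ^(q/2) U^p)^(1/q) (κ^(q/2))^(1/q) (U^p)^(1/p - 1/q)`. The
  -- weights sum to one, and the last is nonnegative because `p ≤ 2 ≤ q`.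
  have hpt : ∀ t, ∫⁻ s, κ (t - s) * U s ≤
      (∫⁻ s, κ (t - s) ^ (q / 2) * U s ^ p) ^ (1 / q) * (I ^ (1 / q) * J ^ (1 / p - 1 / q)) := by
    intro t
    have hκt : Measurable fun s => κ (t - s) ^ (q / 2) := hκr.comp (measurable_const.sub measurable_id)
    have h := ENNReal.lintegral_prod_norm_pow_le (μ := (volume : Measure ℝ)) (Finset.univ : Finset (Fin 3))
      (f := ![fun s => κ (t - s) ^ (q / 2) * U s ^ p, fun s => κ (t - s) ^ (q / 2),
        fun s => U s ^ p]) (p := ![1 / q, 1 / q, 1 / p - 1 / q])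
      (by
        intro i _
        fin_cases i
        exacts [hκt.aemeasurable.mul hUp, hκt.aemeasurable, hUp])
      (by simp [Fin.sum_univ_three]; simpa [one_div, add_comm] using hinv)
      (by
        intro i _
        fin_cases i
        exacts [one_div_nonneg.2 hq0.le, one_div_nonneg.2 hq0.le, hw])
    simp only [Fin.prod_univ_three, Matrix.cons_val_zero, Matrix.cons_val_one, Matrix.cons_val] at h
    have hIt : ∫⁻ s, κ (t - s) ^ (q / 2) = I := lintegral_sub_left_eq_self (fun s => κ s ^ (q / 2)) t
    rw [hIt, mul_assoc] at h
    refine le_trans (le_of_eq (lintegral_congr fun s => ?_)) h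
    rw [ENNReal.mul_rpow_of_nonneg _ _ (by positivity), ← ENNReal.rpow_mul, ← ENNReal.rpow_mul,
      ← ENNReal.rpow_mul]
    have ea : q / 2 * (1 / q) = 1 / 2 := by field_simp
    rw [ea, mul_right_comm (κ (t - s) ^ _), mul_assoc,
      ← ENNReal.rpow_add_of_nonneg (1 / 2) (1 / 2) (by norm_num) (by norm_num),
      ← ENNReal.rpow_add_of_nonneg (p * (1 / q)) (p * (1 / p - 1 / q)) (by positivity)
        (mul_nonneg hp0.le hw)]
    have eb : p * (1 / q) + p * (1 / p - 1 / q) = 1 := by field_simp; ring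
    rw [eb]; norm_num
  calc ∫⁻ t, (∫⁻ s, κ (t - s) * U s) ^ q
      ≤ ∫⁻ t, (∫⁻ s, κ (t - s) ^ (q / 2) * U s ^ p) * (I * J ^ (q / p - 1)) := by
        refine lintegral_mono fun t => ?_
        refine (ENNReal.rpow_le_rpow (hpt t) hq0.le).trans (le_of_eq ?_)
        rw [ENNReal.mul_rpow_of_nonneg _ _ hq0.le, ENNReal.mul_rpow_of_nonneg _ _ hq0.le,
          ← ENNReal.rpow_mul, ← ENNReal.rpow_mul, ← ENNReal.rpow_mul]
        have ea : 1 / q * q = 1 := by field_simp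
        have eb : (1 / p - 1 / q) * q = q / p - 1 := by field_simp
        rw [ea, eb, ENNReal.rpow_one, ENNReal.rpow_one]
    _ = (∫⁻ t, ∫⁻ s, κ (t - s) ^ (q / 2) * U s ^ p) * (I * J ^ (q / p - 1)) := by
        refine lintegral_mul_const'' _ ?_
        refine AEMeasurable.lintegral_prod_right' (f := fun z : ℝ × ℝ =>
          κ (z.1 - z.2) ^ (q / 2) * U z.2 ^ p) ?_
        exact (hκr.comp (measurable_fst.sub measurable_snd)).aemeasurable.mul
          (hUp.comp_quasiMeasurePreserving Measure.quasiMeasurePreserving_snd)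
    _ = (I * J) * (I * J ^ (q / p - 1)) := by
        congr 1
        rw [lintegral_lintegral_swap]
        · have : ∀ s, ∫⁻ t, κ (t - s) ^ (q / 2) * U s ^ p = I * U s ^ p := fun s => by
            rw [lintegral_mul_const (f := fun t => κ (t - s) ^ (q / 2)) _
                (hκr.comp (measurable_id.sub_const s)),
              lintegral_sub_right_eq_self (fun t => κ t ^ (q / 2)) s]
          simp_rw [this]
          rw [lintegral_const_mul'' _ hUp]
        · exact (hκr.comp (measurable_fst.sub measurable_snd)).aemeasurable.mul
            (hUp.comp_quasiMeasurePreserving Measure.quasiMeasurePreserving_snd)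
    _ = I ^ (2 : ℝ) * J ^ (q / p) := by
        have hqp : q / p = 1 + (q / p - 1) := by ring
        have hqp1 : 0 ≤ q / p - 1 := by
          rw [sub_nonneg, one_le_div hp0]; linarith
        conv_rhs => rw [hqp, ENNReal.rpow_add_of_nonneg _ _ zero_le_one hqp1, ENNReal.rpow_one,
          ENNReal.rpow_two]
        ring

theorem memLp_convolution {p q : ℝ≥0∞} [p.HolderConjugate q] (hp1 : 1 < p) (hp2 : p ≤ 2)
    {κ U : ℝ → ℝ} (hκm : Measurable κ) (hκ : MemLp κ (q / 2)) (hU : MemLp U p) :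
    (∀ᵐ t, Integrable fun s => κ (t - s) * U s) ∧
      MemLp (fun t => ∫ s, κ (t - s) * U s) q ∧
      eLpNorm (fun t => ∫ s, κ (t - s) * U s) q volume
        ≤ eLpNorm κ (q / 2) volume * eLpNorm U p volume := by
  have hp0 : p ≠ 0 := (zero_lt_one.trans hp1).ne'
  have hptop : p ≠ ∞ := (hp2.trans_lt (by norm_num)).ne
  have hq0 : q ≠ 0 := ENNReal.HolderConjugate.ne_zero q p
  have hqtop : q ≠ ∞ := by
    rw [ENNReal.HolderConjugate.ne_top_iff_ne_one q p]
    exact hp1.ne'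
  have hpq : p.toReal.HolderConjugate q.toReal := 
    ENNReal.HolderConjugate.toReal (by
      rw [← ENNReal.toReal_one]
      exact (ENNReal.toReal_lt_toReal (by norm_num) hptop).2 hp1)
  have hp2' : p.toReal ≤ 2 := by simpa using ENNReal.toReal_mono (by norm_num) hp2
  have hq2 : (q / 2).toReal = q.toReal / 2 := by simp
  have hqpos : 0 < q.toReal := hpq.symm.pos
  have hppos : 0 < p.toReal := hpq.pos
  have h := lintegral_convolution_rpow_le hpq hp2' (κ := fun t => ‖κ t‖ₑ) (U := fun t => ‖U t‖ₑ)
    hκm.enorm hU.1.enorm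
  simp only [← enorm_mul] at h
  have hκn : eLpNorm κ (q / 2) volume = (∫⁻ t, ‖κ t‖ₑ ^ (q.toReal / 2)) ^ (2 / q.toReal) := by
    rw [eLpNorm_eq_lintegral_rpow_enorm_toReal (by simp [hq0])
      (ENNReal.div_ne_top hqtop (by norm_num)), hq2]
    congr 1
    field_simp
  have hUn : eLpNorm U p volume = (∫⁻ t, ‖U t‖ₑ ^ p.toReal) ^ (1 / p.toReal) :=
    eLpNorm_eq_lintegral_rpow_enorm_toReal hp0 hptop
  have hbound : (∫⁻ t, (∫⁻ s, ‖κ (t - s) * U s‖ₑ) ^ q.toReal) ^ (1 / q.toReal)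
      ≤ eLpNorm κ (q / 2) volume * eLpNorm U p volume := by
    refine (ENNReal.rpow_le_rpow h (by positivity)).trans (le_of_eq ?_)
    rw [ENNReal.mul_rpow_of_nonneg _ _ (by positivity), ← ENNReal.rpow_mul, ← ENNReal.rpow_mul,
      hκn, hUn]
    congr 2 <;> field_simp
  have hfin : eLpNorm κ (q / 2) volume * eLpNorm U p volume < ∞ := ENNReal.mul_lt_top hκ.2 hU.2
  have hmeas : AEStronglyMeasurable (fun z : ℝ × ℝ => κ (z.1 - z.2) * U z.2)
      (volume.prod volume) :=
    (hκm.comp (measurable_fst.sub measurable_snd)).aestronglyMeasurable.mul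
      (hU.1.comp_quasiMeasurePreserving Measure.quasiMeasurePreserving_snd)
  have hnorm : eLpNorm (fun t => ∫ s, κ (t - s) * U s) q volume
      ≤ eLpNorm κ (q / 2) volume * eLpNorm U p volume := by
    refine le_trans ?_ hbound
    rw [eLpNorm_eq_lintegral_rpow_enorm_toReal hq0 hqtop]
    gcongr with t
    exact enorm_integral_le_lintegral_enorm _
  refine ⟨?_, ⟨hmeas.integral_prod_right', hnorm.trans_lt hfin⟩, hnorm⟩
  have hlt : ∫⁻ t, (∫⁻ s, ‖κ (t - s) * U s‖ₑ) ^ q.toReal < ∞ := by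
    have := hbound.trans_lt hfin
    rwa [ENNReal.rpow_lt_top_iff_of_pos (by positivity)] at this
  filter_upwards [ae_lt_top' (hmeas.enorm.lintegral_prod_right'.pow_const _) hlt.ne,
    hmeas.prodMk_left] with t ht htm
  exact ⟨htm, by rwa [ENNReal.rpow_lt_top_iff_of_pos hqpos] at ht⟩

/-- Truncating both factors to `(0, T)` turns the Volterra integral into a convolution on the line:
`t - s > 0` forces `s < t`, and `t - s < T` is then automatic. -/
theorem indicator_mul_indicator_convolution {T t : ℝ} (ht : t ∈ Ioo 0 T) (k u : ℝ → ℝ) :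
    (fun s => (Ioo 0 T).indicator k (t - s) * (Ioo 0 T).indicator u s)
      = (Ioo 0 t).indicator fun s => k (t - s) * u s := by
  ext s
  by_cases hs : s ∈ Ioo 0 t
  · have h1 : s ∈ Ioo 0 T := ⟨hs.1, hs.2.trans ht.2⟩
    have h2 : t - s ∈ Ioo 0 T := ⟨by linarith [hs.2], by linarith [hs.1, ht.2]⟩
    simp [hs, h1, h2]
  · rw [indicator_of_notMem hs, mul_eq_zero]
    by_cases h1 : s ∈ Ioo 0 T
    · refine Or.inl (indicator_of_notMem (fun h2 => hs ⟨h1.1, by linarith [h2.1]⟩) _)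
    · exact Or.inr (indicator_of_notMem h1 _)

theorem integral_convolution_indicator_eq_volterraIntegral {T t : ℝ} (ht : t ∈ Ioo 0 T)
    (k u : ℝ → ℝ) :
    ∫ s, (Ioo 0 T).indicator k (t - s) * (Ioo 0 T).indicator u s = volterraIntegral k u t := by
  rw [indicator_mul_indicator_convolution ht, integral_indicator measurableSet_Ioo,
    volterraIntegral, intervalIntegral.integral_of_le ht.1.le, integral_Ioc_eq_integral_Ioo]

theorem exists_volterra_clm {p q : ℝ≥0∞} [Fact (1 ≤ p)] [Fact (1 ≤ q)] [p.HolderConjugate q]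
    (hp1 : 1 < p) (hp2 : p ≤ 2) {T : ℝ} {k : ℝ → ℝ} (hkm : Measurable ((Ioo 0 T).indicator k))
    (hk : MemLp k (q / 2) (intervalMeasure T)) :
    ∃ A : Lp ℝ p (intervalMeasure T) →L[ℝ] Lp ℝ q (intervalMeasure T),
      ∀ u : Lp ℝ p (intervalMeasure T), ∀ᵐ t ∂(intervalMeasure T),
        IntervalIntegrable (fun τ => k (t - τ) * u τ) volume 0 t ∧
          A u t = volterraIntegral k u t := by
  set κ := (Ioo 0 T).indicator k with hκdef
  have hκ : MemLp κ (q / 2) := (memLp_indicator_iff_restrict measurableSet_Ioo).2 hk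
  have hind : ∀ u : Lp ℝ p (intervalMeasure T), MemLp ((Ioo 0 T).indicator u) p := fun u =>
    (memLp_indicator_iff_restrict measurableSet_Ioo).2 (Lp.memLp u)
  have hY := fun u => memLp_convolution hp1 hp2 hkm hκ (hind u)
  have hval : ∀ u : Lp ℝ p (intervalMeasure T),
      ((hY u).2.1.restrict (Ioo 0 T)).toLp =ᵐ[intervalMeasure T]
        fun t => ∫ s, κ (t - s) * (Ioo 0 T).indicator u s := fun u => MemLp.coeFn_toLp _
  have hint : ∀ u : Lp ℝ p (intervalMeasure T), ∀ᵐ t ∂(intervalMeasure T),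
      Integrable fun s => κ (t - s) * (Ioo 0 T).indicator u s := fun u =>
    ae_restrict_of_ae (hY u).1
  let A₀ : Lp ℝ p (intervalMeasure T) →ₗ[ℝ] Lp ℝ q (intervalMeasure T) :=
    { toFun := fun u => ((hY u).2.1.restrict (Ioo 0 T)).toLp
      map_add' := fun u v => by
        refine Lp.ext ?_
        have huv := (ae_restrict_iff' measurableSet_Ioo).1 (Lp.coeFn_add u v)
        filter_upwards [hval (u + v), hval u, hval v, hint u, hint v,
          Lp.coeFn_add ((hY u).2.1.restrict (Ioo 0 T)).toLp
            ((hY v).2.1.restrict (Ioo 0 T)).toLp] with t h1 h2 h3 h4 h5 h6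
        rw [h1, h6, Pi.add_apply, h2, h3, ← integral_add h4 h5]
        refine integral_congr_ae ?_
        filter_upwards [huv] with s hs
        by_cases hmem : s ∈ Ioo 0 T
        · simp only [indicator_of_mem hmem, hs hmem, Pi.add_apply, mul_add]
        · simp [hmem]
      map_smul' := fun c u => by
        refine Lp.ext ?_
        have hcu := (ae_restrict_iff' measurableSet_Ioo).1 (Lp.coeFn_smul c u)
        filter_upwards [hval (c • u), hval u,
          Lp.coeFn_smul c ((hY u).2.1.restrict (Ioo 0 T)).toLp] with t h1 h2 h3
        rw [h1, RingHom.id_apply, h3, Pi.smul_apply, h2, smul_eq_mul, ← integral_const_mul]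
        refine integral_congr_ae ?_
        filter_upwards [hcu] with s hs
        by_cases hmem : s ∈ Ioo 0 T
        · simp [hmem, hs hmem, mul_left_comm]
        · simp [hmem] }
  refine ⟨A₀.mkContinuous (eLpNorm κ (q / 2) volume).toReal fun u => ?_, fun u => ?_⟩
  · change ‖((hY u).2.1.restrict (Ioo 0 T)).toLp‖ ≤ _
    rw [Lp.norm_toLp, Lp.norm_def, ← ENNReal.toReal_mul,
      ← eLpNorm_indicator_eq_eLpNorm_restrict (f := u) measurableSet_Ioo]
    refine ENNReal.toReal_mono (ENNReal.mul_lt_top hκ.2 (hind u).2).ne ?_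
    exact (eLpNorm_mono_measure _ Measure.restrict_le_self).trans (hY u).2.2
  · filter_upwards [hval u, hint u, ae_restrict_mem measurableSet_Ioo] with t h1 h2 ht
    refine ⟨?_, h1.trans (integral_convolution_indicator_eq_volterraIntegral ht k u)⟩
    rw [intervalIntegrable_iff_integrableOn_Ioo_of_le ht.1.le]
    rw [indicator_mul_indicator_convolution ht] at h2
    exact (integrable_indicator_iff measurableSet_Ioo).1 h2

/-! ### Fourier analysis on the circle -/

section Circle

open AddCircle ComplexConjugate

variable {T : ℝ} [hT : Fact (0 < T)]

theorem fourierCoeff_convolution {f g : AddCircle T → ℂ} (hf : Integrable f haarAddCircle)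
    (hg : Integrable g haarAddCircle) (n : ℤ) :
    fourierCoeff (fun x => ∫ y, f y * g (x - y) ∂haarAddCircle) n
      = fourierCoeff f n * fourierCoeff g n := by
  have h := integral_convolution (ContinuousLinearMap.mul ℂ ℂ)
    (hf.fourier_smul (-n)) (hg.fourier_smul (-n))
  rw [ContinuousLinearMap.mul_apply'] at h
  rw [fourierCoeff, fourierCoeff, fourierCoeff, ← h]
  refine integral_congr_ae (ae_of_all _ fun x => ?_)
  simp only [convolution_def, ContinuousLinearMap.mul_apply', smul_eq_mul]
  rw [← integral_const_mul]
  refine integral_congr_ae (ae_of_all _ fun y => ?_)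
  have : fourier (-n) x = fourier (-n) y * fourier (-n) (x - y) := by
    simp only [fourier_apply]
    rw [← Circle.coe_mul, ← toCircle_add, ← smul_add, add_sub_cancel]
  simp only [this]
  ring

theorem hasSum_conj_fourierCoeff_mul_fourierCoeff {f g : AddCircle T → ℂ}
    (hf : MemLp f 2 haarAddCircle) (hg : MemLp g 2 haarAddCircle) :
    HasSum (fun n => conj (fourierCoeff f n) * fourierCoeff g n)
      (∫ x, conj (f x) * g x ∂haarAddCircle) := by
  have h := fourierBasis.hasSum_inner_mul_inner hf.toLp hg.toLp
  have hc : ∀ {f : AddCircle T → ℂ} (hf : MemLp f 2 haarAddCircle) (n : ℤ),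
      inner ℂ (fourierBasis n) hf.toLp = fourierCoeff f n := fun hf n => by
    rw [← HilbertBasis.repr_apply_apply, fourierBasis_repr]
    exact congrFun (fourierCoeff_congr_ae hf.coeFn_toLp) n
  convert! h using 1
  · ext n
    rw [hc hg, ← inner_conj_symm, hc hf]
  · rw [L2.inner_def]
    refine integral_congr_ae ?_
    filter_upwards [hf.coeFn_toLp, hg.coeFn_toLp] with x h1 h2
    rw [h1, h2, RCLike.inner_apply']

/-- By Parseval the form is the sum of these terms over all `n`, each with nonnegative real part.
One term suffices later, and unlike the series it is easily controlled in `L^p`. -/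
theorem re_fourierCoeff_mul_normSq_le {f g : AddCircle T → ℂ} {C : ℝ}
    (hf : AEStronglyMeasurable f haarAddCircle) (hfC : ∀ x, ‖f x‖ ≤ C)
    (hg : Integrable g haarAddCircle) (hpos : ∀ n, 0 ≤ (fourierCoeff g n).re) (n : ℤ) :
    (fourierCoeff g n).re * ‖fourierCoeff f n‖ ^ 2 ≤
      (∫ x, conj (f x) * ∫ y, f y * g (x - y) ∂haarAddCircle ∂haarAddCircle).re := by
  have hfi : Integrable f haarAddCircle := Integrable.of_bound hf C (ae_of_all _ hfC)
  have hf2 : MemLp f 2 haarAddCircle := MemLp.of_bound hf C (ae_of_all _ hfC)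
  have hmeas := (hfi.convolution_integrand (ContinuousLinearMap.mul ℂ ℂ) hg).1
  have hconv : MemLp (fun x => ∫ y, f y * g (x - y) ∂haarAddCircle) 2 haarAddCircle := by
    refine MemLp.of_bound hmeas.integral_prod_right' (C * ∫ y, ‖g y‖ ∂haarAddCircle)
      (ae_of_all _ fun x => ?_)
    have hgx : Integrable (fun y => C * ‖g (x - y)‖) haarAddCircle :=
      (hg.comp_sub_left x).norm.const_mul C
    refine (norm_integral_le_of_norm_le hgx (ae_of_all _ fun y => ?_)).trans (le_of_eq ?_)
    · simp only [norm_mul]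
      exact mul_le_mul_of_nonneg_right (hfC y) (norm_nonneg _)
    · rw [integral_const_mul, integral_sub_left_eq_self (fun y => ‖g y‖)]
  have h := (hasSum_conj_fourierCoeff_mul_fourierCoeff hf2 hconv)
  simp only [fourierCoeff_convolution hfi hg] at h
  have hterm : ∀ m, (conj (fourierCoeff f m) * (fourierCoeff f m * fourierCoeff g m)).re
      = (fourierCoeff g m).re * ‖fourierCoeff f m‖ ^ 2 := fun m => by
    rw [← mul_assoc, Complex.conj_mul', ← Complex.ofReal_pow, Complex.re_ofReal_mul, mul_comm]
  have hre := Complex.hasSum_re h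
  simp only [hterm] at hre
  exact le_hasSum hre n fun m _ => mul_nonneg (hpos m) (sq_nonneg _)

/-- Pairing with `f` is a continuous functional on `L^q` that kills the exponentials. Their span is
dense for `q ≠ ∞`, so it also kills indicators. The Hilbert basis of `L^2` would not cover `p < 2`.
-/
theorem ae_eq_zero_of_fourierCoeff_eq_zero {p q : ℝ≥0∞} [Fact (1 ≤ p)] [Fact (1 ≤ q)]
    [p.HolderConjugate q] (hq : q ≠ ∞) {f : AddCircle T → ℂ}
    (hf : MemLp f p haarAddCircle) (h : ∀ n, fourierCoeff f n = 0) : f =ᵐ[haarAddCircle] 0 := by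
  set Φ : Lp ℂ q haarAddCircle →L[ℂ] ℂ :=
    (ContinuousLinearMap.mul ℂ ℂ).lpPairing haarAddCircle p q hf.toLp with hΦ
  have hval : ∀ g, Φ g = ∫ x, f x * g x ∂haarAddCircle := fun g => by
    rw [hΦ, ContinuousLinearMap.lpPairing_eq_integral]
    refine integral_congr_ae ?_
    filter_upwards [hf.coeFn_toLp] with x hx
    rw [hx, ContinuousLinearMap.mul_apply']
  have hker : (⊤ : Submodule ℂ (Lp ℂ q haarAddCircle)) ≤ Φ.ker := by
    rw [← span_fourierLp_closure_eq_top (T := T) (p := q) hq]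
    refine Submodule.topologicalClosure_minimal _ (Submodule.span_le.2 ?_) Φ.isClosed_ker
    rintro _ ⟨n, rfl⟩
    rw [SetLike.mem_coe, LinearMap.mem_ker, ContinuousLinearMap.coe_coe, hval]
    have := h (-n)
    rw [fourierCoeff, neg_neg] at this
    rw [← this]
    refine integral_congr_ae ?_
    filter_upwards [coeFn_fourierLp q n] with x hx
    rw [hx, smul_eq_mul, mul_comm]
  have hfi : Integrable f haarAddCircle := hf.integrable (Fact.out : 1 ≤ p)
  refine hfi.ae_eq_zero_of_forall_setIntegral_eq_zero fun s hs _ => ?_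
  have hz : Φ (indicatorConstLp q hs (measure_ne_top _ s) 1) = 0 := hker Submodule.mem_top
  rw [hval] at hz
  rw [← hz, ← integral_indicator hs]
  refine integral_congr_ae ?_
  filter_upwards [indicatorConstLp_coeFn (p := q) (hs := hs)
    (hμs := measure_ne_top haarAddCircle s) (c := (1 : ℂ))] with x hx
  rw [hx]
  by_cases hxs : x ∈ s <;> simp [hxs]

end Circle

/-! ### From the circle of length `2T` to the interval `(0, T)` -/

section Transfer

open AddCircle ComplexConjugate

variable {T : ℝ} [hT2 : Fact (0 < 2 * T)]

theorem integral_liftIoc_mul {f : ℝ → ℂ} (hf : ∀ t ∉ Ioo 0 T, f t = 0)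
    (g : AddCircle (2 * T) → ℂ) :
    ∫ x, liftIoc (2 * T) 0 f x * g x ∂haarAddCircle = ((2 * T)⁻¹ : ℝ) * ∫ t, f t * g t := by
  have hT : 0 < T := by linarith [hT2.out]
  have hset : ∫ t in Ioc 0 (0 + 2 * T), f t * g t = ∫ t : ℝ, f t * g t :=
    setIntegral_eq_integral_of_forall_compl_eq_zero fun t ht => by
      rw [hf t fun h => ht ⟨h.1, by linarith [h.2]⟩, zero_mul]
  rw [integral_haarAddCircle, ← AddCircle.integral_preimage (2 * T) 0, Complex.real_smul, ← hset]
  congr 1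
  refine setIntegral_congr_fun measurableSet_Ioc fun t ht => ?_
  simp only [liftIoc_coe_apply ht]

/-- Exactly one indicator is active, according to the sign of `t - s`. The diagonal is excluded
because the lift takes there the uncontrolled value `k 0`. -/
theorem liftIoc_comp_min_reflect_sub {t s : ℝ} (ht : t ∈ Ioo 0 T) (hs : s ∈ Ioo 0 T)
    (hts : t ≠ s) (k : ℝ → ℝ) :
    liftIoc (2 * T) 0 (fun x => (k (min x (2 * T - x)) : ℂ)) ((t : AddCircle (2 * T)) - s)
      = (((Ioo 0 T).indicator k (t - s) + (Ioo 0 T).indicator k (s - t) : ℝ) : ℂ) := by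
  obtain ⟨ht0, htT⟩ := ht
  obtain ⟨hs0, hsT⟩ := hs
  rcases lt_or_gt_of_ne hts with h | h
  · have e : (t : AddCircle (2 * T)) - s = ((t - s + 2 * T : ℝ) : AddCircle (2 * T)) := by
      rw [AddCircle.coe_add_period, AddCircle.coe_sub]
    rw [e, liftIoc_coe_apply ⟨by linarith, by linarith⟩, min_eq_right (by linarith),
      indicator_of_notMem (fun h' => by linarith [h'.1]),
      indicator_of_mem (mem_Ioo.2 ⟨by linarith, by linarith⟩ : s - t ∈ Ioo 0 T), zero_add]
    congr 2
    ring
  · rw [← AddCircle.coe_sub, liftIoc_coe_apply ⟨by linarith, by linarith⟩,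
      min_eq_left (by linarith),
      indicator_of_mem (mem_Ioo.2 ⟨by linarith, by linarith⟩ : t - s ∈ Ioo 0 T),
      indicator_of_notMem (fun h' => by linarith [h'.1]), add_zero]

theorem integrable_liftIoc {f : ℝ → ℂ} (hf : IntervalIntegrable f volume 0 (2 * T)) :
    Integrable (liftIoc (2 * T) 0 f) haarAddCircle := by
  rw [← memLp_one_iff_integrable, memLp_haarAddCircle_iff]
  refine MemLp.memLp_liftIoc ?_
  rw [memLp_one_iff_integrable, zero_add]
  exact (intervalIntegrable_iff_integrableOn_Ioc_of_le hT2.out.le).1 hf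

theorem re_fourierCoeff_liftIoc {f : ℝ → ℝ} (hf : IntervalIntegrable f volume 0 (2 * T)) (n : ℤ) :
    (fourierCoeff (liftIoc (2 * T) 0 fun x => (f x : ℂ)) n).re =
      (2 * T)⁻¹ * ∫ x in (0 : ℝ)..(2 * T), f x * Real.cos (2 * Real.pi * n / (2 * T) * x) := by
  have hfc : IntervalIntegrable (fun x => (f x : ℂ)) volume 0 (2 * T) :=
    ⟨hf.1.ofReal, hf.2.ofReal⟩
  have hlift : ∫ x in (0 : ℝ)..(0 + 2 * T), fourier (-n) (x : AddCircle (2 * T)) •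
      liftIoc (2 * T) 0 (fun x => (f x : ℂ)) x
      = ∫ x in (0 : ℝ)..(2 * T), fourier (-n) (x : AddCircle (2 * T)) * (f x : ℂ) := by
    rw [intervalIntegral.integral_of_le (by linarith [hT2.out]),
      intervalIntegral.integral_of_le hT2.out.le]
    simp_rw [zero_add]
    refine setIntegral_congr_fun measurableSet_Ioc fun x hx => ?_
    simp only [smul_eq_mul]
    rw [liftIoc_coe_apply (by rwa [zero_add])]
  have hint : IntervalIntegrable
      (fun x : ℝ => fourier (-n) (x : AddCircle (2 * T)) * (f x : ℂ)) volume 0 (2 * T) :=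
    hfc.continuousOn_mul (((map_continuous (fourier (-n))).comp
      (AddCircle.continuous_mk' (2 * T))).continuousOn)
  rw [fourierCoeff_eq_intervalIntegral _ _ 0, hlift, one_div, Complex.smul_re, smul_eq_mul]
  congr 1
  have h := Complex.reCLM.intervalIntegral_comp_comm hint
  refine h.symm.trans ?_
  refine intervalIntegral.integral_congr fun x _ => ?_
  simp only [Complex.reCLM_apply, Complex.re_mul_ofReal, fourier_coe_apply]
  rw [mul_comm]
  congr 1
  have : 2 * (Real.pi : ℂ) * Complex.I * ((-n : ℤ) : ℂ) * (x : ℂ) / ((2 * T : ℝ) : ℂ)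
      = ((-(2 * Real.pi * n / (2 * T) * x) : ℝ) : ℂ) * Complex.I := by
    push_cast
    ring
  rw [this, Complex.exp_ofReal_mul_I_re, Real.cos_neg]

theorem re_fourierCoeff_comp_min_reflect_pos {k : ℝ → ℝ} (hk : StrictConvexOn ℝ (Ioc 0 T) k)
    (ha : AntitoneOn k (Ioc 0 T)) (hi : IntervalIntegrable k volume 0 T)
    (hm : 0 < ∫ t in (0 : ℝ)..T, k t) (n : ℤ) :
    0 < (fourierCoeff (liftIoc (2 * T) 0 fun x => (k (min x (2 * T - x)) : ℂ)) n).re := by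
  have hT : 0 < T := by linarith [hT2.out]
  obtain ⟨hi', hint⟩ := intervalIntegrable_comp_min_reflect hT hi
  rw [re_fourierCoeff_liftIoc hi']
  refine mul_pos (inv_pos.2 hT2.out) ?_
  -- Evenness of the cosine reduces negative frequencies to positive ones.
  have habs : ∀ x : ℝ, Real.cos (2 * Real.pi * n / (2 * T) * x)
      = Real.cos (2 * Real.pi * n.natAbs / (2 * T) * x) := fun x => by
    rcases Int.natAbs_eq n with h | h <;> rw [h]
    · simp
    · rw [← Real.cos_neg]
      congr 1
      push_cast
      simp
      ring
  simp only [habs]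
  rcases Nat.eq_zero_or_pos n.natAbs with h0 | h0
  · simp only [h0, Nat.cast_zero, mul_zero, zero_div, zero_mul, Real.cos_zero, mul_one, hint]
    positivity
  · exact (hk.comp_min_reflect ha).integral_mul_cos_pos hT2.out hi' h0

/-- Fubini exchanges the two halves of the symmetrized kernel, whence the factor 2. Boundedness of
`U` makes the double integral absolutely convergent for a merely integrable `κ`. -/
theorem integral_mul_symm_kernel {κ U : ℝ → ℝ} {C : ℝ} (hκ : Integrable κ) (hU : Integrable U)
    (hUC : ∀ x, ‖U x‖ ≤ C) :
    ∫ t, U t * ∫ s, U s * (κ (t - s) + κ (s - t)) = 2 * ∫ t, (∫ s, κ (t - s) * U s) * U t := by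
  have hprod : Integrable (fun z : ℝ × ℝ => κ (z.1 - z.2) * U z.2 * U z.1)
      (volume.prod volume) := by
    have h := hU.convolution_integrand (ContinuousLinearMap.mul ℝ ℝ).flip hκ
    simp only [ContinuousLinearMap.flip_apply, ContinuousLinearMap.mul_apply'] at h
    exact h.mul_bdd (c := C)
      (hU.1.comp_quasiMeasurePreserving Measure.quasiMeasurePreserving_fst)
      (ae_of_all _ fun z => hUC z.1)
  have hswap := integral_integral_swap (f := fun t s => κ (t - s) * U s * U t) hprod
  have h1 : ∀ t, Integrable fun s => U s * κ (t - s) := fun t =>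
    (hκ.comp_sub_left t).bdd_mul (c := C) hU.1 (ae_of_all _ hUC)
  have h2 : ∀ t, Integrable fun s => U s * κ (s - t) := fun t =>
    (hκ.comp_sub_right t).bdd_mul (c := C) hU.1 (ae_of_all _ hUC)
  have hi1 : Integrable fun t => ∫ s, κ (t - s) * U s * U t := hprod.integral_prod_left
  have hi2 : Integrable fun t => ∫ s, κ (s - t) * U t * U s := hprod.integral_prod_right
  have e : ∀ t, U t * ∫ s, U s * (κ (t - s) + κ (s - t))
      = (∫ s, κ (t - s) * U s * U t) + ∫ s, κ (s - t) * U t * U s := fun t => by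
    simp_rw [mul_add (U _)]
    rw [integral_add (h1 t) (h2 t), mul_add, ← integral_const_mul, ← integral_const_mul]
    congr 1 <;> exact integral_congr_ae (ae_of_all _ fun s => by ring)
  simp_rw [e]
  rw [integral_add hi1 hi2, ← hswap, two_mul]
  simp_rw [integral_mul_const]

theorem re_fourierCoeff_mul_normSq_le_quadratic {k U : ℝ → ℝ} {C : ℝ}
    (hk : StrictConvexOn ℝ (Ioc 0 T) k)
    (ha : AntitoneOn k (Ioc 0 T)) (hi : IntervalIntegrable k volume 0 T)
    (hm : 0 < ∫ t in (0 : ℝ)..T, k t) (hU : AEStronglyMeasurable U) (hUC : ∀ x, ‖U x‖ ≤ C)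
    (hU0 : ∀ t ∉ Ioo 0 T, U t = 0) (n : ℤ) :
    (fourierCoeff (liftIoc (2 * T) 0 fun x => (k (min x (2 * T - x)) : ℂ)) n).re *
      ‖∫ t : ℝ, fourier (-n) (t : AddCircle (2 * T)) * (U t : ℂ)‖ ^ 2 ≤
      2 * ∫ t, (∫ s, (Ioo 0 T).indicator k (t - s) * U s) * U t := by
  have hT : 0 < T := by linarith [hT2.out]
  set κ := (Ioo 0 T).indicator k with hκdef
  set K := liftIoc (2 * T) 0 fun x => (k (min x (2 * T - x)) : ℂ) with hK
  set V := liftIoc (2 * T) 0 fun x => (U x : ℂ) with hV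
  have hκ : Integrable κ := by
    rw [hκdef, integrable_indicator_iff measurableSet_Ioo]
    exact (intervalIntegrable_iff_integrableOn_Ioo_of_le hT.le).1 hi
  have hUc0 : ∀ t ∉ Ioo 0 T, (U t : ℂ) = 0 := fun t ht => by rw [hU0 t ht, Complex.ofReal_zero]
  have hUi : Integrable U := by
    have : U = (Ioo 0 T).indicator U := by
      ext t
      by_cases ht : t ∈ Ioo 0 T
      · simp [ht]
      · simp [ht, hU0 t ht]
    rw [this, integrable_indicator_iff measurableSet_Ioo]
    exact Measure.integrableOn_of_bounded (M := C) (by simp) hU (ae_of_all _ hUC)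
  have hVi : Integrable V haarAddCircle :=
    integrable_liftIoc (hUi.ofReal.intervalIntegrable)
  have hiK := (intervalIntegrable_comp_min_reflect hT hi).1
  have hKi : Integrable K haarAddCircle :=
    integrable_liftIoc ⟨hiK.1.ofReal, hiK.2.ofReal⟩
  have hVC : ∀ x, ‖V x‖ ≤ C := fun x => by
    simp only [hV, liftIoc, Function.comp_apply, Set.domRestrict_apply, Complex.norm_real]
    exact hUC _
  have hVconj : ∀ x, conj (V x) = V x := fun x => by
    simp only [hV, liftIoc, Function.comp_apply, Set.domRestrict_apply, Complex.conj_ofReal]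
  have h := re_fourierCoeff_mul_normSq_le hVi.1 hVC hKi
    (fun m => (re_fourierCoeff_comp_min_reflect_pos hk ha hi hm m).le) n
  have hcoef : fourierCoeff V n = ((2 * T)⁻¹ : ℝ) *
      ∫ t : ℝ, fourier (-n) (t : AddCircle (2 * T)) * (U t : ℂ) := by
    simp only [fourierCoeff, smul_eq_mul]
    simp_rw [mul_comm (fourier (-n) _)]
    exact integral_liftIoc_mul hUc0 _
  have hquad : ∫ x, conj (V x) * ∫ y, V y * K (x - y) ∂haarAddCircle ∂haarAddCircle
      = (((2 * T)⁻¹ ^ 2 * (2 * ∫ t, (∫ s, κ (t - s) * U s) * U t) : ℝ) : ℂ) := by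
    simp_rw [hVconj]
    rw [integral_liftIoc_mul hUc0]
    simp_rw [hV, integral_liftIoc_mul hUc0]
    rw [← integral_mul_symm_kernel hκ hUi hUC, pow_two, mul_assoc, Complex.ofReal_mul,
      Complex.ofReal_mul, ← integral_complex_ofReal]
    congr 1
    rw [← integral_const_mul]
    refine integral_congr_ae (ae_of_all _ fun t => ?_)
    simp only
    by_cases ht : t ∈ Ioo 0 T
    · rw [mul_left_comm, Complex.ofReal_mul, ← integral_complex_ofReal]
      congr 2
      refine integral_congr_ae ?_
      filter_upwards [Measure.ae_ne volume t] with s hs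
      by_cases hs' : s ∈ Ioo 0 T
      · rw [hK, liftIoc_comp_min_reflect_sub ht hs' (Ne.symm hs)]
        push_cast
        ring
      · simp [hU0 s hs']
    · simp [hU0 t ht]
  rw [hquad, hcoef, Complex.ofReal_re, norm_mul, Complex.norm_real, mul_pow, Real.norm_eq_abs,
    sq_abs, mul_left_comm] at h
  -- Normalized Haar measure leaves the same factor `(2T)⁻²` on both sides.
  exact le_of_mul_le_mul_left h (by have := hT2.out; positivity)

theorem ae_eq_zero_of_integral_fourier_eq_zero {p q : ℝ≥0∞} [Fact (1 ≤ p)] [Fact (1 ≤ q)]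
    [p.HolderConjugate q] (hq : q ≠ ∞) {U : ℝ → ℝ} (hU : MemLp U p) (hU0 : ∀ t ∉ Ioo 0 T, U t = 0)
    (h : ∀ n, ∫ t : ℝ, fourier (-n) (t : AddCircle (2 * T)) * (U t : ℂ) = 0) :
    ∀ᵐ t ∂(intervalMeasure T), U t = 0 := by
  have hT : 0 < T := by linarith [hT2.out]
  have hUc0 : ∀ t ∉ Ioo 0 T, (U t : ℂ) = 0 := fun t ht => by rw [hU0 t ht, Complex.ofReal_zero]
  have hV : MemLp (liftIoc (2 * T) 0 fun x => (U x : ℂ)) p haarAddCircle :=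
    (MemLp.memLp_liftIoc (hU.ofReal.restrict _)).haarAddCircle
  have hz := ae_eq_zero_of_fourierCoeff_eq_zero (p := p) (q := q) hq hV fun n => by
    simp only [fourierCoeff, smul_eq_mul]
    simp_rw [mul_comm (fourier (-n) _)]
    rw [integral_liftIoc_mul hUc0]
    simp_rw [mul_comm _ (fourier (-n) _)]
    rw [h, mul_zero]
  have hz' : liftIoc (2 * T) 0 (fun x => (U x : ℂ)) =ᵐ[volume] 0 := by
    rw [volume_eq_smul_haarAddCircle]
    exact Measure.ae_smul_measure hz _
  have := (AddCircle.measurePreserving_mk (2 * T) 0).quasiMeasurePreserving.ae hz'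
  rw [zero_add] at this
  have hsub : Ioo 0 T ⊆ Ioc 0 (2 * T) := fun t ht => ⟨ht.1, by linarith [ht.2]⟩
  filter_upwards [ae_restrict_of_ae_restrict_of_subset hsub this,
    ae_restrict_mem measurableSet_Ioo] with t ht hmem
  rw [liftIoc_coe_apply (by simpa using! hsub hmem)] at ht
  simpa using ht

end Transfer

/-! ### Continuity in `L^p` and extension by density -/

theorem dualityPairing_eq_lpPairing {α : Type*} [MeasurableSpace α] {μ : Measure α} {p q : ℝ≥0∞}
    [Fact (1 ≤ p)] [Fact (1 ≤ q)] [p.HolderConjugate q] (f : Lp ℝ q μ) (u : Lp ℝ p μ) :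
    dualityPairing f u = (ContinuousLinearMap.mul ℝ ℝ).lpPairing μ p q u f := by
  rw [ContinuousLinearMap.lpPairing_eq_integral, dualityPairing]
  simp only [ContinuousLinearMap.mul_apply', mul_comm]

theorem continuous_dualityPairing_self {α : Type*} [MeasurableSpace α] {μ : Measure α}
    {p q : ℝ≥0∞} [Fact (1 ≤ p)] [Fact (1 ≤ q)] [p.HolderConjugate q]
    (A : Lp ℝ p μ →L[ℝ] Lp ℝ q μ) : Continuous fun u => dualityPairing (A u) u := by
  simp_rw [dualityPairing_eq_lpPairing]
  fun_prop

theorem continuous_integral_mul_Lp {α : Type*} [MeasurableSpace α] {μ : Measure α} {p q : ℝ≥0∞}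
    [Fact (1 ≤ p)] [Fact (1 ≤ q)] [p.HolderConjugate q] {g : α → ℂ} (hg : MemLp g q μ) :
    Continuous fun u : Lp ℝ p μ => ∫ x, g x * (u x : ℂ) ∂μ := by
  have h : ∀ u : Lp ℝ p μ, ∫ x, g x * (u x : ℂ) ∂μ =
      (ContinuousLinearMap.lsmul ℝ ℝ : ℝ →L[ℝ] ℂ →L[ℝ] ℂ).lpPairing μ p q u hg.toLp := fun u => by
    rw [ContinuousLinearMap.lpPairing_eq_integral]
    refine integral_congr_ae ?_
    filter_upwards [hg.coeFn_toLp] with x hx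
    rw [hx, ContinuousLinearMap.lsmul_apply, Complex.real_smul, mul_comm]
  simp_rw [h]
  fun_prop

theorem integral_convolution_indicator_mul_indicator {T : ℝ} (k u : ℝ → ℝ) :
    ∫ t, (∫ s, (Ioo 0 T).indicator k (t - s) * (Ioo 0 T).indicator u s) * (Ioo 0 T).indicator u t
      = ∫ t, volterraIntegral k u t * u t ∂(intervalMeasure T) := by
  rw [← integral_indicator measurableSet_Ioo]
  refine integral_congr_ae (ae_of_all _ fun t => ?_)
  by_cases ht : t ∈ Ioo 0 T
  · simp only [integral_convolution_indicator_eq_volterraIntegral ht, indicator_of_mem ht]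
  · simp [ht]

theorem integral_fourier_mul_indicator {T : ℝ} (n : ℤ) (u : ℝ → ℝ) :
    ∫ t : ℝ, fourier n (t : AddCircle (2 * T)) * (((Ioo 0 T).indicator u t : ℝ) : ℂ)
      = ∫ t, fourier n (t : AddCircle (2 * T)) * (u t : ℂ) ∂(intervalMeasure T) := by
  rw [← integral_indicator measurableSet_Ioo]
  refine integral_congr_ae (ae_of_all _ fun t => ?_)
  by_cases ht : t ∈ Ioo 0 T <;> simp [ht]

section Coercivity

open AddCircle

variable {T : ℝ} [hT2 : Fact (0 < 2 * T)]

/-- Both sides are continuous in `u`, so the inequality extends from simple functions, which are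
bounded and, for `p ≠ ∞`, dense. -/
theorem dualityPairing_volterra_ge {p q : ℝ≥0∞} [Fact (1 ≤ p)] [Fact (1 ≤ q)] [p.HolderConjugate q]
    (hp : p ≠ ∞) {k : ℝ → ℝ} (hk : StrictConvexOn ℝ (Ioc 0 T) k)
    (ha : AntitoneOn k (Ioc 0 T)) (hi : IntervalIntegrable k volume 0 T)
    (hm : 0 < ∫ t in (0 : ℝ)..T, k t)
    (A : Lp ℝ p (intervalMeasure T) →L[ℝ] Lp ℝ q (intervalMeasure T))
    (hA : ∀ u : Lp ℝ p (intervalMeasure T), A u =ᵐ[intervalMeasure T] volterraIntegral k u)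
    (n : ℤ) (u : Lp ℝ p (intervalMeasure T)) :
    (fourierCoeff (liftIoc (2 * T) 0 fun x => (k (min x (2 * T - x)) : ℂ)) n).re *
      ‖∫ t, fourier (-n) (t : AddCircle (2 * T)) * (u t : ℂ) ∂(intervalMeasure T)‖ ^ 2 ≤
      2 * dualityPairing (A u) u := by
  have hg : MemLp (fun t : ℝ => fourier (-n) (t : AddCircle (2 * T))) q (intervalMeasure T) := by
    refine MemLp.of_bound (((map_continuous (fourier (-n))).comp
      (AddCircle.continuous_mk' (2 * T))).aestronglyMeasurable) 1 (ae_of_all _ fun t => ?_)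
    rw [fourier_apply, Circle.norm_coe]
  have hclosed := isClosed_le
    (((continuous_integral_mul_Lp (p := p) hg).norm.pow 2).const_mul
      (fourierCoeff (liftIoc (2 * T) 0 fun x => (k (min x (2 * T - x)) : ℂ)) n).re)
    ((continuous_dualityPairing_self A).const_mul 2)
  refine (Lp.simpleFunc.denseRange hp).induction_on u hclosed fun v => ?_
  set f := Lp.simpleFunc.toSimpleFunc v with hf
  have hvf : f =ᵐ[intervalMeasure T] (v : Lp ℝ p (intervalMeasure T)) :=
    Lp.simpleFunc.toSimpleFunc_eq_toFun v
  obtain ⟨C, hC⟩ := f.exists_forall_norm_le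
  have hind : (Ioo 0 T).indicator (v : Lp ℝ p (intervalMeasure T)) =ᵐ[volume]
      (Ioo 0 T).indicator f :=
    (ae_eq_restrict_iff_indicator_ae_eq measurableSet_Ioo).1 hvf.symm
  have hU : AEStronglyMeasurable ((Ioo 0 T).indicator f) :=
    (f.stronglyMeasurable.indicator measurableSet_Ioo).aestronglyMeasurable
  have h := re_fourierCoeff_mul_normSq_le_quadratic hk ha hi hm hU (C := C)
    (fun x => (norm_indicator_le_norm_self _ _).trans (hC x))
    (fun t ht => indicator_of_notMem ht _) n
  have hF : ∫ t, fourier (-n) (t : AddCircle (2 * T)) * (f t : ℂ) ∂(intervalMeasure T)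
      = ∫ t, fourier (-n) (t : AddCircle (2 * T)) * ((v : Lp ℝ p (intervalMeasure T)) t : ℂ)
        ∂(intervalMeasure T) := by
    refine integral_congr_ae ?_
    filter_upwards [hvf] with t ht
    rw [ht]
  rw [integral_fourier_mul_indicator, hF, integral_convolution_indicator_mul_indicator] at h
  refine h.trans (le_of_eq ?_)
  rw [dualityPairing]
  congr 1
  refine integral_congr_ae ?_
  filter_upwards [hvf, hA v, ae_restrict_mem measurableSet_Ioo] with t h1 h2 ht
  rw [h1, h2, ← integral_convolution_indicator_eq_volterraIntegral ht,
    ← integral_convolution_indicator_eq_volterraIntegral ht]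
  congr 1
  refine integral_congr_ae ?_
  filter_upwards [hind] with s hs
  rw [hs]

end Coercivity

/-! ### Strict monotonicity of the Volterra operator -/

theorem mainTheorem7 (p q : ℝ≥0∞) [Fact (1 ≤ p)] [Fact (1 ≤ q)] [p.HolderConjugate q]
    (hp1 : 1 < p) (hp2 : p ≤ 2) (T : ℝ) (hT : 0 < T) (k : ℝ → ℝ)
    (hk_conv : StrictConvexOn ℝ (Ioc 0 T) k) (hk_anti : AntitoneOn k (Ioc 0 T))
    (hk_mem : MemLp k (q / 2) (intervalMeasure T))
    (hk_mean : 0 < ∫ t in (0 : ℝ)..T, k t) :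
    ∃ A : Lp ℝ p (intervalMeasure T) →L[ℝ] Lp ℝ q (intervalMeasure T),
      (∀ u : Lp ℝ p (intervalMeasure T), ∀ᵐ t ∂(intervalMeasure T),
        IntervalIntegrable (fun τ => k (t - τ) * u τ) volume 0 t ∧
          A u t = volterraIntegral k u t) ∧
      IsStrictlyMonotoneMap A := by
  have : Fact (0 < 2 * T) := ⟨by linarith⟩
  have hptop : p ≠ ∞ := (hp2.trans_lt (by norm_num)).ne
  have hqtop : q ≠ ∞ := by
    rw [ENNReal.HolderConjugate.ne_top_iff_ne_one q p]
    exact hp1.ne'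
  -- This gives `L^(q/2) ⊆ L^1` on the bounded interval, so `k` is integrable.
  have hq2 : 1 ≤ q / 2 := by
    rw [ENNReal.le_div_iff_mul_le (by norm_num) (by norm_num), one_mul, ← ENNReal.inv_le_inv,
      ← ENNReal.HolderConjugate.one_sub_inv p q, ← ENNReal.one_sub_inv_two]
    exact tsub_le_tsub_left (ENNReal.inv_le_inv.2 hp2) 1
  have hcont : ContinuousOn k (Ioo 0 T) := by
    have h := (hk_conv.subset Ioo_subset_Ioc_self (convex_Ioo 0 T)).convexOn.continuousOn_interior
    rwa [interior_Ioo] at h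
  -- Convexity makes `k` continuous on the open interval, hence the truncation is genuinely
  -- measurable, not just almost everywhere.
  have hkm : Measurable ((Ioo 0 T).indicator k) := by
    rw [← piecewise_eq_indicator]
    exact hcont.measurable_piecewise continuousOn_const measurableSet_Ioo
  have hki : IntervalIntegrable k volume 0 T :=
    (intervalIntegrable_iff_integrableOn_Ioo_of_le hT.le).2 (hk_mem.integrable hq2)
  obtain ⟨A, hA⟩ := exists_volterra_clm hp1 hp2 hkm hk_mem
  have hpair := dualityPairing_volterra_ge hptop hk_conv hk_anti hki hk_mean A
    (fun u => (hA u).mono fun t ht => ht.2)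
  have hcoef := re_fourierCoeff_comp_min_reflect_pos hk_conv hk_anti hki hk_mean
  refine ⟨A, hA, fun u v => ?_, fun u v huv => ?_⟩
  · rw [← map_sub]
    -- Any frequency would do in place of 0.
    have := (mul_nonneg (hcoef 0).le (sq_nonneg _)).trans (hpair 0 (u - v))
    linarith
  · rw [← map_sub] at huv
    rw [← sub_eq_zero]
    set w := u - v with hw
    have hU : MemLp ((Ioo 0 T).indicator w) p :=
      (memLp_indicator_iff_restrict measurableSet_Ioo).2 (Lp.memLp w)
    have hz := ae_eq_zero_of_integral_fourier_eq_zero (q := q) hqtop hU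
      (fun t ht => indicator_of_notMem ht _) fun n => by
        rw [integral_fourier_mul_indicator]
        have h := hpair n w
        rw [huv, mul_zero] at h
        -- The weight is strictly positive at every frequency, so a vanishing form annihilates each
        -- Fourier coefficient of `w`.
        have h0 : ‖∫ t, fourier (-n) (t : AddCircle (2 * T)) * (w t : ℂ)
            ∂(intervalMeasure T)‖ ^ 2 ≤ 0 := by
          by_contra hcon
          push Not at hcon
          exact absurd h (not_le.2 (mul_pos (hcoef n) hcon))
        exact norm_eq_zero.1 (pow_eq_zero_iff two_ne_zero |>.1 (le_antisymm h0 (sq_nonneg _)))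
    refine (Lp.eq_zero_iff_ae_eq_zero).2 ?_
    filter_upwards [hz, ae_restrict_mem measurableSet_Ioo] with t ht hmem
    simpa [hmem] using ht
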